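/- Let $\Omega\subset\mathbb{R}^2$ be a polygonal domain (a bounded, connected, open set whose boundary is a finite union of line segments). Let $\mathbf a=[a_{ij}]$ be a symmetric $2\times2$ matrix of functions $a_{ij}\in W^{1,\infty}(\Omega)$ (taken as their continuous representatives) such that, for some $r>0$, $\sum_{i,j}a_{ij}(x)\xi_i\xi_j\ge r\sum_j\xi_j^2$ for all $x\in\Omega$, $\xi\in\mathbb{R}^2$, and let $b$ be a nonnegative real function that is smooth on $\overline\Omega$. A triangulation $\mathcal T$ of $\Omega$ is a finite set of closed nondegenerate triangles with pairwise disjoint interiors contained in $\Omega$ and with union $\overline\Omega$, such that no vertex of one triangle lies in the relative interior of an edge of another one and every vertex of $\Omega$ is a vertex of a triangle. Let $\mathcal M_{\mathcal T}$ be the set of midpoints of the edges of $\mathcal T$. The Crouzeix–Raviart trial space $\mathbb U_{\mathcal T}$ consists of the functions that are affine on each $K\in\mathcal T$, continuous at each $M\in\mathcal M_{\mathcal T}\setminus\partial\Omega$, and zero at each $M\in\mathcal M_{\mathcal T}\cap\partial\Omega$. For $M\in\mathcal M_{\mathcal T}$ the control volume $K^*_M$ is the union of the triangles spanned by the edge with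 midpoint $M$ and the barycenters of the triangles of $\mathcal T$ having this edge; $\mathcal T^*=\{K^*_M: M\in\mathcal M_{\mathcal T}\}$, and $\Pi_{\mathcal T^*}w=\sum_{M\in\mathcal M_{\mathcal T}}w(M)\chi_{K^*_M}$ for $w\in\mathbb U_{\mathcal T}$. For $w\in\mathbb U_{\mathcal T}$ and $v$ constant on each control volume put $$a_{\mathcal T}(w,v)=\sum_{K\in\mathcal T}\sum_{K^*\in\mathcal T^*}\Big(\int_{K^*\cap K}b\,w\,v-\int_{\partial K^*\cap\operatorname{int}K}v\,(\mathbf a\nabla w)\cdot\mathbf n\,ds\Big),\qquad \|w\|_{1,\mathcal T}=\Big(\sum_{K\in\mathcal T}\int_K|\nabla w|^2\Big)^{1/2},$$ where in the second integral $v$ is its constant value on $K^*$ and $\mathbf n$ is the outward unit normal on $\partial K^*$. A family $\mathscr T$ of triangulations of $\Omega$ is regular with constant $\varrho>0$ if $\varrho_K\ge\varrho h_K$ for all $K\in\mathcal T\in\mathscr T$, where $h_K$ is the diameter of $K$ and $\varrho_K$ the diameter of the largest disc contained in $K$. Let $h=\sup\{h_K: K\in\mathcal T\in\mathscr T\}$.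 Then for every $\varrho>0$ there is $h_0>0$, depending only on $\Omega,\mathbf a,b,\varrho$ (and $r$), such that for every family $\mathscr T$ of triangulations of $\Omega$ that is regular with constant $\varrho$ and has $h<h_0$, the family of discrete bilinear forms $a_{\mathcal T}(\cdot,\Pi_{\mathcal T^*}\cdot)$, $\mathcal T\in\mathscr T$, is uniformly elliptic: there exists $\sigma>0$ such that $$a_{\mathcal T}(w,\Pi_{\mathcal T^*}w)\ge\sigma\|w\|_{1,\mathcal T}^2\qquad\text{for all }\mathcal T\in\mathscr T\text{ and all }w\in\mathbb U_{\mathcal T}.$$ -/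

import Mathlib

open MeasureTheory Set
open scoped Matrix ContDiff

noncomputable section

namespace CRFVM

/-- The Euclidean plane `ℝ²`. -/
abbrev Plane := EuclideanSpace ℝ (Fin 2)

/-! ### The boundary value problem -/

/-- A polygonal domain: a bounded, connected (nonempty), open set whose boundary consists of finitely
many line segments. -/
structure IsPolygonalDomain (Ω : Set Plane) : Prop where
  isOpen : IsOpen Ω
  isConnected : IsConnected Ω
  isBounded : Bornology.IsBounded Ω
  polygonal_boundary : ∃ S : Finset (Plane × Plane), frontier Ω = ⋃ s ∈ S, segment ℝ s.1 s.2

/-- A vertex of `Ω`: a boundary point near which the boundary is not a piece of a straight line. -/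
def IsDomainVertex (Ω : Set Plane) (p : Plane) : Prop :=
  p ∈ frontier Ω ∧
    ¬ ∃ v : Plane, v ≠ 0 ∧ ∃ ε > 0,
      frontier Ω ∩ Metric.ball p ε = {x | ∃ t : ℝ, x = p + t • v} ∩ Metric.ball p ε

/-- `g` is the weak partial derivative of `u` in the `i`-th coordinate direction on `Ω`. -/
def IsWeakPartialDeriv (Ω : Set Plane) (i : Fin 2) (u g : Plane → ℝ) : Prop :=
  ∀ φ : Plane → ℝ, ContDiff ℝ ∞ φ → HasCompactSupport φ → tsupport φ ⊆ Ω →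
    ∫ x in Ω, u x * fderiv ℝ φ x (EuclideanSpace.single i 1) = - ∫ x in Ω, g x * φ x

/-- The Sobolev space `W^{1,∞}(Ω)`: `u` and its weak first order derivatives are in `L^∞(Ω)`. -/
def MemW1Infty (Ω : Set Plane) (u : Plane → ℝ) : Prop :=
  MemLp u ⊤ (volume.restrict Ω) ∧
    ∀ i, ∃ g : Plane → ℝ, MemLp g ⊤ (volume.restrict Ω) ∧ IsWeakPartialDeriv Ω i u g

/-! ### Triangles -/

/-- The closed triangle with the vertices of `K`. -/
def closedTriangle (K : Affine.Triangle ℝ Plane) : Set Plane :=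
  convexHull ℝ (range K.points)

/-- The midpoint of the side of `K` opposite to the `i`-th vertex. -/
def edgeMidpoint (K : Affine.Triangle ℝ Plane) (i : Fin 3) : Plane :=
  midpoint ℝ (K.points (i + 1)) (K.points (i + 2))

/-- The barycenter of `K`. -/
def barycenter (K : Affine.Triangle ℝ Plane) : Plane :=
  (1 / 3 : ℝ) • ∑ i, K.points i

/-- The diameter `h_K` of `K`. -/
def elemDiam (K : Affine.Triangle ℝ Plane) : ℝ :=
  Metric.diam (closedTriangle K)

/-- The diameter `ϱ_K` of the largest disc contained in `K`. -/
def inDiam (K : Affine.Triangle ℝ Plane) : ℝ :=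
  sSup {d | 0 ≤ d ∧ ∃ c, Metric.closedBall c (d / 2) ⊆ closedTriangle K}

/-! ### Triangulations, dual partitions -/

/-- A (finite, conforming) triangulation of `Ω`. -/
structure Triangulation (Ω : Set Plane) where
  elems : Finset (Affine.Triangle ℝ Plane)
  covers : ⋃ K ∈ elems, closedTriangle K = closure Ω
  interior_subset : ∀ K ∈ elems, interior (closedTriangle K) ⊆ Ω
  disjoint_interior : ∀ K ∈ elems, ∀ K' ∈ elems, K ≠ K' →
    Disjoint (interior (closedTriangle K)) (interior (closedTriangle K'))
  no_hanging_nodes : ∀ K ∈ elems, ∀ K' ∈ elems, K ≠ K' → ∀ i j : Fin 3,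
    K.points i ∉ openSegment ℝ (K'.points (j + 1)) (K'.points (j + 2))
  domain_vertices : ∀ p, IsDomainVertex Ω p → ∃ K ∈ elems, ∃ i, K.points i = p

variable {Ω : Set Plane}

namespace Triangulation

open Classical in
/-- The set of midpoints of all the edges of the triangulation. -/
def midpoints (T : Triangulation Ω) : Finset Plane :=
  T.elems.biUnion fun K => Finset.univ.image (edgeMidpoint K)

theorem edgeMidpoint_mem_closedTriangle (K : Affine.Triangle ℝ Plane) (i : Fin 3) :
    edgeMidpoint K i ∈ closedTriangle K :=
  (convex_convexHull ℝ _).segment_subset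
    (subset_convexHull ℝ _ (mem_range_self (i + 1)))
    (subset_convexHull ℝ _ (mem_range_self (i + 2)))
    (midpoint_mem_segment _ _)

theorem exists_elem_of_mem_midpoints (T : Triangulation Ω) (M : T.midpoints) :
    ∃ K : T.elems, (M : Plane) ∈ closedTriangle (K : Affine.Triangle ℝ Plane) := by
  obtain ⟨M, hM⟩ := M
  simp only [midpoints, Finset.mem_biUnion, Finset.mem_image, Finset.mem_univ, true_and] at hM
  obtain ⟨K, hK, i, rfl⟩ := hM
  exact ⟨⟨K, hK⟩, edgeMidpoint_mem_closedTriangle K i⟩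

/-- The control volume `K*_M` of the edge midpoint `M`: the union of the triangles spanned by the edge
with midpoint `M` and the barycenters of the elements having this edge (a quadrilateral if there are
two of them, a triangle if there is one). The dual partition is the family of all `K*_M`. -/
def controlVolume (T : Triangulation Ω) (M : Plane) : Set Plane :=
  {x | ∃ K ∈ T.elems, ∃ i : Fin 3, edgeMidpoint K i = M ∧
    x ∈ convexHull ℝ {K.points (i + 1), K.points (i + 2), barycenter K}}

/-! ### Trial and test spaces -/

/-- The Crouzeix–Raviart space: an element is given by its affine restrictions `w K` to the elements;
it is continuous at the edge midpoints in `Ω` and vanishes at the edge midpoints on `∂Ω`. -/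
def trialSpace (T : Triangulation Ω) : Submodule ℝ (T.elems → (Plane →ᵃ[ℝ] ℝ)) where
  carrier := {w |
    (∀ M ∈ T.midpoints, M ∉ frontier Ω → ∀ K K' : T.elems,
      M ∈ closedTriangle (K : Affine.Triangle ℝ Plane) →
      M ∈ closedTriangle (K' : Affine.Triangle ℝ Plane) → w K M = w K' M) ∧
    (∀ M ∈ T.midpoints, M ∈ frontier Ω → ∀ K : T.elems,
      M ∈ closedTriangle (K : Affine.Triangle ℝ Plane) → w K M = 0)}
  zero_mem' := by simp
  add_mem' := by
    rintro u v ⟨hu, hu'⟩ ⟨hv, hv'⟩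
    refine ⟨fun M hM hb K K' hK hK' => ?_, fun M hM hb K hK => ?_⟩
    · simp [hu M hM hb K K' hK hK', hv M hM hb K K' hK hK']
    · simp [hu' M hM hb K hK, hv' M hM hb K hK]
  smul_mem' := by
    rintro c u ⟨hu, hu'⟩
    refine ⟨fun M hM hb K K' hK hK' => ?_, fun M hM hb K hK => ?_⟩
    · simp [hu M hM hb K K' hK hK']
    · simp [hu' M hM hb K hK]

/-- The test space: functions which are constant on every control volume (`v M` is the value on
`K*_M`) and vanish on `∂Ω`. -/
def testSpace (T : Triangulation Ω) : Submodule ℝ (T.midpoints → ℝ) where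
  carrier := {v | ∀ M : T.midpoints, (M : Plane) ∈ frontier Ω → v M = 0}
  zero_mem' := by simp
  add_mem' := by
    intro u v hu hv M hM
    simp [hu M hM, hv M hM]
  smul_mem' := by
    intro c u hu M hM
    simp [hu M hM]

/-- The map `Π w = ∑_M w(M) χ_{K*_M}` from the trial space to the test space. The value `w(M)` is that
of the restriction of `w` to any element containing `M`. -/
def proj (T : Triangulation Ω) : T.trialSpace →ₗ[ℝ] T.testSpace where
  toFun w := ⟨fun M => w.1 (T.exists_elem_of_mem_midpoints M).choose M, fun M hM =>
    w.2.2 M M.2 hM _ (T.exists_elem_of_mem_midpoints M).choose_spec⟩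
  map_add' _ _ := rfl
  map_smul' _ _ := rfl

theorem proj_apply (T : Triangulation Ω) (w : T.trialSpace) (M : T.midpoints) (K : T.elems)
    (hK : (M : Plane) ∈ closedTriangle (K : Affine.Triangle ℝ Plane)) :
    (T.proj w).1 M = w.1 K M := by
  by_cases hb : (M : Plane) ∈ frontier Ω
  · rw [(T.proj w).2 M hb, w.2.2 M M.2 hb K hK]
  · exact w.2.1 M M.2 hb _ K (T.exists_elem_of_mem_midpoints M).choose_spec hK

end Triangulation

/-! ### The discrete bilinear form -/

/-- The line integral `∫_{[p,q]} f ds` with respect to arc length. -/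
def segmentIntegral (p q : Plane) (f : Plane → ℝ) : ℝ :=
  ‖q - p‖ * ∫ t in (0 : ℝ)..1, f (AffineMap.lineMap p q t)

/-- Rotation by a right angle. -/
def rot (v : Plane) : Plane := !₂[-(v 1), v 0]

/-- The unit normal vector on the side `[p,q]` of the triangle `p q c` that is outward, that is, points
away from `c`. -/
def outwardNormal (p q c : Plane) : Plane :=
  if 0 < inner ℝ (rot (q - p)) (c - p) then -(‖q - p‖⁻¹ • rot (q - p))
  else ‖q - p‖⁻¹ • rot (q - p)

open Classical in
/-- The integral `∫_{∂K*_M ∩ int K} F(x, n) ds`, where `n` is the outward unit normal on `∂K*_M`.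
If `M` is the midpoint of the side `P P'` of `K` and `Q` is the barycenter of `K`, then
`∂K*_M ∩ int K` consists of the two segments `P Q` and `P' Q` (without the end points `P`, `P'`);
otherwise it is empty. -/
def innerBoundaryIntegral (K : Affine.Triangle ℝ Plane) (M : Plane) (F : Plane → Plane → ℝ) : ℝ :=
  ∑ i : Fin 3, if edgeMidpoint K i = M then
    segmentIntegral (K.points (i + 1)) (barycenter K)
      (fun x => F x (outwardNormal (K.points (i + 1)) (barycenter K) (K.points (i + 2)))) +
    segmentIntegral (K.points (i + 2)) (barycenter K)
      (fun x => F x (outwardNormal (K.points (i + 2)) (barycenter K) (K.points (i + 1))))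
  else 0

namespace Triangulation

/-- `a_K(w, v) = ∑_{K*} (∫_{K* ∩ K} b w v - ∫_{∂K* ∩ int K} v (a ∇w) · n)` for a function `w` on `K` and
a function `v` which is constant on every control volume. -/
def localForm (T : Triangulation Ω) (a : Plane → Matrix (Fin 2) (Fin 2) ℝ) (b : Plane → ℝ)
    (K : Affine.Triangle ℝ Plane) (w : Plane → ℝ) (v : T.midpoints → ℝ) : ℝ :=
  ∑ M : T.midpoints,
    ((∫ x in T.controlVolume M ∩ closedTriangle K, b x * w x * v M) -
      innerBoundaryIntegral K M
        (fun x n => v M * ((a x *ᵥ (gradient w x).ofLp) ⬝ᵥ n.ofLp)))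

/-- The discrete bilinear form `a_𝒯(w, v) = ∑_K a_K(w, v)`. -/
def form (T : Triangulation Ω) (a : Plane → Matrix (Fin 2) (Fin 2) ℝ) (b : Plane → ℝ)
    (w : T.elems → Plane → ℝ) (v : T.midpoints → ℝ) : ℝ :=
  ∑ K : T.elems, T.localForm a b K (w K) v

/-- The mesh dependent norm `‖w‖_{1,𝒯} = (∑_K ∫_K |∇w|²)^{1/2}`. -/
def brokenNorm (T : Triangulation Ω) (w : T.elems → Plane → ℝ) : ℝ :=
  √(∑ K : T.elems, ∫ x in closedTriangle (K : Affine.Triangle ℝ Plane), ‖gradient (w K) x‖ ^ 2)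

end Triangulation

/-! ### Families of triangulations -/

/-- The family `𝒯` is regular with constant `ϱ`. -/
def IsRegularWith (ϱ : ℝ) (𝒯 : Set (Triangulation Ω)) : Prop :=
  ∀ T ∈ 𝒯, ∀ K ∈ T.elems, ϱ * elemDiam K ≤ inDiam K

/-- The mesh size `h`: the largest diameter of the elements of the triangulations in `𝒯`
(all of them are subsets of the closure of `Ω`). -/
def meshSize (𝒯 : Set (Triangulation Ω)) : ℝ :=
  sSup {d | ∃ T ∈ 𝒯, ∃ K ∈ T.elems, d = elemDiam K}

/-- Uniform ellipticity of the family of the discrete bilinear forms `a_𝒯(·, Π ·)`. -/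
def UniformlyElliptic (a : Plane → Matrix (Fin 2) (Fin 2) ℝ) (b : Plane → ℝ)
    (𝒯 : Set (Triangulation Ω)) : Prop :=
  ∃ σ : ℝ, 0 < σ ∧ ∀ T ∈ 𝒯, ∀ w : T.trialSpace,
    σ * T.brokenNorm (fun K => w.1 K) ^ 2 ≤ T.form a b (fun K => w.1 K) (T.proj w).1

end CRFVM

end

namespace CRFVM

/-! ### Lipschitz continuity of functions in `W^{1,∞}` -/

/-! The estimate is local: on each element `K`, the form dominates a fixed multiple of the Dirichlet
energy, and summing over `K` suffices. Let `w` have constant gradient `g` on `K` and let `h` be the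
diameter of `K`.

Diffusion. The segment from a vertex to the barycenter is shared by two pieces of control volumes,
with opposite normals, so its flux is multiplied by the difference of `w` at two edge midpoints,
which is half the increment of `w` along the opposite side, up to sign. For a constant matrix `A`
the three terms add up exactly to `|K| (A g · g)` (`sum_const_flux`). A continuous `W^{1,∞}`
function is Lipschitz along segments in `Ω` (by mollification), so freezing the coefficients at the
barycenter costs `O(h) h² ‖g‖²` (`le_diffusion`).

Reaction. With `m` the midpoint value, `w m = (m + (w - m)/2)² - (w - m)²/4`. Since `b ≥ 0`, only
the oscillation `|w - m| ≤ ‖g‖ h` can do harm, and the loss is `O(h²) ‖g‖² |K|`; no Poincaré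
inequality is needed (`neg_le_setIntegral_reaction`).

Regularity gives `ϱ h² ≤ 2 |K|` (`mul_elemDiam_sq_le`), so both losses are absorbed by the main term
`r |K| ‖g‖²` once `h` is small. -/

theorem exists_ae_abs_le_of_memLp_top {α : Type*} [MeasurableSpace α] {μ : Measure α} {g : α → ℝ}
    (hg : MemLp g ⊤ μ) : ∃ C : ℝ, 0 ≤ C ∧ ∀ᵐ x ∂μ, |g x| ≤ C := by
  refine ⟨(eLpNorm g ⊤ μ).toReal, ENNReal.toReal_nonneg, ?_⟩
  have h1 := ae_le_eLpNormEssSup (f := g) (μ := μ)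
  have h2 : eLpNorm g ⊤ μ ≠ ⊤ := hg.2.ne
  rw [← eLpNorm_exponent_top] at h1
  filter_upwards [h1] with x hx
  have := ENNReal.toReal_mono h2 hx
  simpa using this

theorem abs_integral_mul_fderiv_le {Ω : Set Plane} {i : Fin 2} {u g φ : Plane → ℝ} {C : ℝ}
    (hu : IsWeakPartialDeriv Ω i u g) (hC : 0 ≤ C)
    (hg : ∀ᵐ x ∂volume.restrict Ω, |g x| ≤ C) (hφ : ContDiff ℝ ∞ φ) (hcs : HasCompactSupport φ)
    (hsub : tsupport φ ⊆ Ω) (h0 : ∀ x, 0 ≤ φ x) :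
    |∫ x in Ω, u x * fderiv ℝ φ x (EuclideanSpace.single i 1)| ≤ C * ∫ x, φ x := by
  have hint : Integrable φ := hφ.continuous.integrable_of_hasCompactSupport hcs
  rw [hu φ hφ hcs hsub, abs_neg, ← integral_const_mul]
  calc |∫ x in Ω, g x * φ x| ≤ ∫ x in Ω, C * φ x := by
        rw [← Real.norm_eq_abs]
        refine norm_integral_le_of_norm_le (hint.const_mul C).integrableOn ?_
        filter_upwards [hg] with x hx
        rw [Real.norm_eq_abs, abs_mul, abs_of_nonneg (h0 x)]
        exact mul_le_mul_of_nonneg_right hx (h0 x)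
    _ ≤ ∫ x, C * φ x :=
        setIntegral_le_integral (hint.const_mul C) (.of_forall fun x => mul_nonneg hC (h0 x))

theorem norm_le_of_abs_apply_single_le {f : Plane →L[ℝ] ℝ} {C : Fin 2 → ℝ}
    (h : ∀ i, |f (EuclideanSpace.single i 1)| ≤ C i) : ‖f‖ ≤ C 0 + C 1 := by
  have hC : ∀ i, 0 ≤ C i := fun i => (abs_nonneg _).trans (h i)
  refine f.opNorm_le_bound (add_nonneg (hC 0) (hC 1)) fun d => ?_
  have hd : d = d 0 • EuclideanSpace.single 0 (1 : ℝ) + d 1 • EuclideanSpace.single 1 (1 : ℝ) := by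
    ext i; fin_cases i <;> simp
  have hn : ∀ i, |d i| ≤ ‖d‖ := fun i => PiLp.norm_apply_le d i
  have e : f d = d 0 * f (EuclideanSpace.single 0 1) + d 1 * f (EuclideanSpace.single 1 1) := by
    conv_lhs => rw [hd]
    simp
  rw [e, Real.norm_eq_abs]
  refine (abs_add_le _ _).trans ?_
  rw [abs_mul, abs_mul]
  have := mul_le_mul (hn 0) (h 0) (abs_nonneg _) (norm_nonneg _)
  have := mul_le_mul (hn 1) (h 1) (abs_nonneg _) (norm_nonneg _)
  linarith

/-- The partial derivative of the mollification at `z` is, up to sign, the integral of `u` against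
the derivative of the reflected kernel centred at `z`. That kernel is a nonnegative test function of
mass one supported in `Ω`, so the weak derivative bounds it by `C i`; the mean value inequality
along the segment concludes. -/
theorem abs_mollify_sub_le {Ω : Set Plane} (hΩ : IsOpen Ω) {u : Plane → ℝ} {g : Fin 2 → Plane → ℝ}
    {C : Fin 2 → ℝ} (hu : MemLp u ⊤ (volume.restrict Ω)) (hC : ∀ i, 0 ≤ C i)
    (hug : ∀ i, IsWeakPartialDeriv Ω i u (g i))
    (hg : ∀ i, ∀ᵐ x ∂volume.restrict Ω, |g i x| ≤ C i) (φ : ContDiffBump (0 : Plane)) {x y : Plane}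
    (hxy : ∀ z ∈ segment ℝ x y, Metric.closedBall z φ.rOut ⊆ Ω) :
    |convolution (φ.normed volume) (Ω.indicator u) (ContinuousLinearMap.lsmul ℝ ℝ) volume y -
      convolution (φ.normed volume) (Ω.indicator u) (ContinuousLinearMap.lsmul ℝ ℝ) volume x| ≤
      (C 0 + C 1) * ‖y - x‖ := by
  set ψ := φ.normed (volume : Measure Plane) with hψ
  have hsm : ContDiff ℝ ∞ ψ := φ.contDiff_normed
  have hcs : HasCompactSupport ψ := φ.hasCompactSupport_normed
  have hloc : LocallyIntegrable (Ω.indicator u) volume :=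
    ((memLp_indicator_iff_restrict hΩ.measurableSet).2 hu).locallyIntegrable le_top
  -- The smooth kernel becomes the right factor, on which the derivative falls.
  rw [← convolution_flip]
  have hder := fun z => hcs.hasFDerivAt_convolution_right (ContinuousLinearMap.lsmul ℝ ℝ).flip hloc
    (hsm.of_le (by norm_cast)) z
  refine Convex.norm_image_sub_le_of_norm_hasFDerivWithin_le
    (fun z _ => (hder z).hasFDerivWithinAt) (fun z hz => ?_) (convex_segment x y)
    (left_mem_segment ℝ x y) (right_mem_segment ℝ x y)
  refine norm_le_of_abs_apply_single_le fun i => ?_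
  rw [convolution_precompR_apply _ hloc (hcs.fderiv ℝ)
    (hsm.continuous_fderiv (by simp))]
  set χ : Plane → ℝ := fun t => ψ (z - t) with hχ
  have hχs : ContDiff ℝ ∞ χ := hsm.comp (contDiff_const.sub contDiff_id)
  have hsupp : tsupport χ ⊆ Metric.closedBall z φ.rOut := by
    refine closure_minimal (fun t ht => ?_) Metric.isClosed_closedBall
    have : z - t ∈ tsupport ψ := subset_tsupport _ ht
    rw [hψ, φ.tsupport_normed_eq] at this
    simpa [dist_eq_norm, norm_sub_rev] using this
  have hχc : HasCompactSupport χ :=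
    (isCompact_closedBall z φ.rOut).of_isClosed_subset (isClosed_tsupport _) hsupp
  have hfd : ∀ t v, fderiv ℝ χ t v = - fderiv ℝ ψ (z - t) v := by
    intro t v
    have h1 : HasFDerivAt ψ (fderiv ℝ ψ (z - t)) (z - t) :=
      (hsm.differentiable (by simp) _).hasFDerivAt
    have h2 := h1.comp t ((hasFDerivAt_id (𝕜 := ℝ) t).const_sub z)
    rw [show χ = ψ ∘ (fun t => z - t) from rfl]
    erw [h2.fderiv]
    simp
  have key := abs_integral_mul_fderiv_le (hug i) (hC i) (hg i) hχs hχc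
    (hsupp.trans (hxy z hz)) (fun t => φ.nonneg_normed _)
  have hone : ∫ t, χ t = 1 := by
    rw [hχ, integral_sub_left_eq_self ψ volume z]
    exact φ.integral_normed
  rw [hone, mul_one] at key
  refine le_trans (le_of_eq ?_) key
  rw [← abs_neg, convolution, ← integral_neg, ← integral_indicator hΩ.measurableSet]
  congr 2
  ext t
  by_cases ht : t ∈ Ω <;> simp [ht, hfd, mul_comm]

/-- A continuous function in `W^{1,∞}(Ω)` is Lipschitz along the segments in `Ω`. -/
theorem MemW1Infty.exists_lipschitz {Ω : Set Plane} (hΩ : IsOpen Ω) {u : Plane → ℝ}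
    (hu : MemW1Infty Ω u) (huc : ContinuousOn u Ω) :
    ∃ L : ℝ, 0 ≤ L ∧ ∀ x y, segment ℝ x y ⊆ Ω → |u y - u x| ≤ L * ‖y - x‖ := by
  obtain ⟨hu, hg⟩ := hu
  choose g hg hug using hg
  choose C hC hgC using fun i => exists_ae_abs_le_of_memLp_top (hg i)
  refine ⟨C 0 + C 1, add_nonneg (hC 0) (hC 1), fun x y hxy => ?_⟩
  have hcpt : IsCompact (segment ℝ x y) := by
    rw [← convexHull_pair (𝕜 := ℝ)]; exact (Set.toFinite {x, y}).isCompact_convexHull (𝕜 := ℝ)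
  obtain ⟨δ, hδ, hδΩ⟩ := hcpt.exists_cthickening_subset_open hΩ hxy
  have hcont : ∀ z ∈ Ω, ∀ η > 0, ∃ ρ > 0, ∀ t ∈ Metric.ball z ρ,
      dist (Ω.indicator u t) (Ω.indicator u z) ≤ η := by
    intro z hz η hη
    have h1 : ContinuousAt u z := huc.continuousAt (hΩ.mem_nhds hz)
    have h2 : ContinuousAt (Ω.indicator u) z :=
      h1.congr (Filter.eventuallyEq_of_mem (hΩ.mem_nhds hz) fun t ht => by simp [ht])
    obtain ⟨ρ, hρ, h⟩ := Metric.continuousAt_iff.1 h2 η hη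
    exact ⟨ρ, hρ, fun t ht => (h ht).le⟩
  have hx : x ∈ Ω := hxy (left_mem_segment ℝ x y)
  have hy : y ∈ Ω := hxy (right_mem_segment ℝ x y)
  have hmeas : AEStronglyMeasurable (Ω.indicator u) volume :=
    ((memLp_indicator_iff_restrict hΩ.measurableSet).2 hu).1
  refine le_of_forall_pos_le_add fun η hη => ?_
  obtain ⟨ρx, hρx, hx'⟩ := hcont x hx (η / 2) (by positivity)
  obtain ⟨ρy, hρy, hy'⟩ := hcont y hy (η / 2) (by positivity)
  -- The radius `δ` keeps the kernel inside `Ω` along the whole segment; `ρx` and `ρy` make the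
  -- mollification `η / 2`-close to `u` at the two ends.
  set ε := min δ (min ρx ρy) with hε
  have hε0 : 0 < ε := by positivity
  let φ : ContDiffBump (0 : Plane) := ⟨ε / 2, ε, by positivity, by linarith⟩
  have h1 := φ.dist_normed_convolution_le hmeas (x₀ := x) (ε := η / 2) fun t ht =>
    hx' t (Metric.ball_subset_ball ((min_le_right _ _).trans (min_le_left _ _)) ht)
  have h2 := φ.dist_normed_convolution_le hmeas (x₀ := y) (ε := η / 2) fun t ht =>
    hy' t (Metric.ball_subset_ball ((min_le_right _ _).trans (min_le_right _ _)) ht)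
  have h3 := abs_mollify_sub_le hΩ hu hC hug hgC φ (x := x) (y := y) fun z hz t ht =>
    hδΩ (Metric.mem_cthickening_of_dist_le t z δ _ hz
      ((Metric.mem_closedBall.1 ht).trans (min_le_left _ _)))
  rw [Real.dist_eq, indicator_of_mem hx] at h1
  rw [Real.dist_eq, indicator_of_mem hy] at h2
  rw [abs_le] at *
  constructor <;> linarith [h1.1, h1.2, h2.1, h2.2, h3.1, h3.2]

/-! ### Geometry of triangles -/

/-- The cross product of two vectors of the plane. -/
def cross (u v : Plane) : ℝ := u 0 * v 1 - u 1 * v 0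

/-- Twice the signed area of a triangle. -/
def signedArea (K : Affine.Triangle ℝ Plane) : ℝ :=
  cross (K.points 1 - K.points 0) (K.points 2 - K.points 0)

theorem inner_eq_coord (u v : Plane) : inner ℝ u v = u 0 * v 0 + u 1 * v 1 := by
  simp [PiLp.inner_apply, Fin.sum_univ_two, mul_comm]

theorem norm_sq_eq_coord (u : Plane) : ‖u‖ ^ 2 = u 0 ^ 2 + u 1 ^ 2 := by
  simp [EuclideanSpace.norm_sq_eq, Fin.sum_univ_two]

theorem inner_rot (u v : Plane) : inner ℝ (rot u) v = cross u v := by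
  rw [inner_eq_coord]
  simp [rot, cross]
  ring

theorem norm_rot (u : Plane) : ‖rot u‖ = ‖u‖ := by
  rw [← sq_eq_sq₀ (norm_nonneg _) (norm_nonneg _), norm_sq_eq_coord, norm_sq_eq_coord]
  simp [rot]
  ring

theorem isLinearMap_cross (u : Plane) : IsLinearMap ℝ (cross u) where
  map_add x y := by simp [cross]; ring
  map_smul c x := by simp [cross]; ring

/-- For an edge vector `e`, the linear form `cross e` agrees at both ends of the edge and changes by
`± signedArea K` at the third vertex. Hence the width of `K` normal to the edge is `|signedArea K| /
‖e‖`. -/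
theorem cross_edge_le (K : Affine.Triangle ℝ Plane) (i j k l : Fin 3) :
    cross (K.points j - K.points i) (K.points k) ≤
      cross (K.points j - K.points i) (K.points l) + |signedArea K| := by
  have h1 := le_abs_self (signedArea K)
  have h2 := neg_abs_le (signedArea K)
  have h3 := abs_nonneg (signedArea K)
  generalize |signedArea K| = D at *
  simp only [signedArea, cross, PiLp.sub_apply] at *
  fin_cases i <;> fin_cases j <;> fin_cases k <;> fin_cases l <;>
    simp only [Fin.zero_eta, Fin.mk_one, Fin.reduceFinMk] <;> linarith

theorem cross_edge_le_of_mem (K : Affine.Triangle ℝ Plane) (i j : Fin 3) {x y : Plane}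
    (hx : x ∈ closedTriangle K) (hy : y ∈ closedTriangle K) :
    cross (K.points j - K.points i) x ≤
      cross (K.points j - K.points i) y + |signedArea K| := by
  set e := K.points j - K.points i
  have h1 : ∀ l, x ∈ {z | cross e z ≤ cross e (K.points l) + |signedArea K|} := fun l =>
    convexHull_min (range_subset_iff.2 fun k => cross_edge_le K i j k l)
      (convex_halfSpace_le (isLinearMap_cross e) _) hx
  have hsub : range K.points ⊆ {z | cross e x - |signedArea K| ≤ cross e z} := by
    rintro _ ⟨l, rfl⟩
    have := h1 l
    simp only [mem_ofPred_eq] at this ⊢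
    linarith
  have h2 := convexHull_min hsub (convex_halfSpace_ge (isLinearMap_cross e) _) hy
  simp only [mem_ofPred_eq] at h2
  linarith

/-- A disc of diameter `d` in `K` cannot exceed the width of `K` normal to the edge: compare `cross
e` at the two ends of the diameter normal to the edge. -/
theorem mul_norm_edge_le (K : Affine.Triangle ℝ Plane) {c : Plane} {d : ℝ} (hd : 0 ≤ d)
    (hc : Metric.closedBall c (d / 2) ⊆ closedTriangle K) (i j : Fin 3) :
    d * ‖K.points j - K.points i‖ ≤ |signedArea K| := by
  set e := K.points j - K.points i with he
  rcases eq_or_ne e 0 with h0 | h0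
  · simp [h0]
  have hn : 0 < ‖e‖ := norm_pos_iff.2 h0
  set n : Plane := (d / 2) • ‖e‖⁻¹ • rot e with hndef
  have hnn : ‖n‖ = d / 2 := by
    rw [hndef, norm_smul, norm_smul, norm_rot, norm_inv, norm_norm, inv_mul_cancel₀ hn.ne',
      Real.norm_of_nonneg (by positivity), mul_one]
  have h1 : c + n ∈ closedTriangle K := hc (by simp [hnn])
  have h2 : c - n ∈ closedTriangle K := hc (by simp [hnn])
  have h3 := cross_edge_le_of_mem K i j h1 h2
  rw [← he] at h3
  have hL := isLinearMap_cross e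
  have h4 : cross e n = (d / 2) * ‖e‖ := by
    have : cross e (rot e) = ‖e‖ ^ 2 := by
      rw [norm_sq_eq_coord]; simp [cross, rot]; ring
    rw [hndef, hL.map_smul, hL.map_smul, this, smul_eq_mul, smul_eq_mul]
    field_simp
  rw [hL.map_add, sub_eq_add_neg, hL.map_add, hL.map_neg, h4] at h3
  linarith

theorem isCompact_closedTriangle (K : Affine.Triangle ℝ Plane) : IsCompact (closedTriangle K) :=
  (Set.finite_range _).isCompact_convexHull (𝕜 := ℝ)

theorem convex_closedTriangle (K : Affine.Triangle ℝ Plane) : Convex ℝ (closedTriangle K) :=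
  convex_convexHull ℝ _

theorem points_mem_closedTriangle (K : Affine.Triangle ℝ Plane) (i : Fin 3) :
    K.points i ∈ closedTriangle K :=
  subset_convexHull ℝ _ (mem_range_self i)

theorem norm_sub_le_elemDiam (K : Affine.Triangle ℝ Plane) {x y : Plane}
    (hx : x ∈ closedTriangle K) (hy : y ∈ closedTriangle K) : ‖x - y‖ ≤ elemDiam K := by
  rw [← dist_eq_norm]
  exact Metric.dist_le_diam_of_mem (isCompact_closedTriangle K).isBounded hx hy

theorem elemDiam_pos (K : Affine.Triangle ℝ Plane) : 0 < elemDiam K := by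
  refine lt_of_lt_of_le (norm_pos_iff.2 (sub_ne_zero.2 ?_))
    (norm_sub_le_elemDiam K (points_mem_closedTriangle K 0) (points_mem_closedTriangle K 1))
  exact K.independent.injective.ne (by decide)

/-- The diameter of a triangle is attained by an edge, since a convex hull has the diameter of its
generating set. -/
theorem mul_elemDiam_le (K : Affine.Triangle ℝ Plane) {c : Plane} {d : ℝ} (hd : 0 ≤ d)
    (hc : Metric.closedBall c (d / 2) ⊆ closedTriangle K) : d * elemDiam K ≤ |signedArea K| := by
  rcases hd.eq_or_lt with rfl | hd'
  · simp
  rw [mul_comm, ← le_div_iff₀ hd', elemDiam, closedTriangle, convexHull_diam]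
  refine Metric.diam_le_of_forall_dist_le (by positivity) ?_
  rintro _ ⟨j, rfl⟩ _ ⟨i, rfl⟩
  rw [dist_eq_norm, le_div_iff₀ hd', mul_comm]
  exact mul_norm_edge_le K hd hc i j

theorem mul_elemDiam_sq_le {K : Affine.Triangle ℝ Plane} {ϱ : ℝ} (h : ϱ * elemDiam K ≤ inDiam K) :
    ϱ * elemDiam K ^ 2 ≤ |signedArea K| := by
  have h0 := elemDiam_pos K
  have : inDiam K ≤ |signedArea K| / elemDiam K :=
    Real.sSup_le (fun d ⟨hd, c, hc⟩ => (le_div_iff₀ h0).2 (mul_elemDiam_le K hd hc)) (by positivity)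
  rw [le_div_iff₀ h0] at this
  nlinarith

theorem volume_closedTriangle_le (K : Affine.Triangle ℝ Plane) :
    volume.real (closedTriangle K) ≤ 4 * elemDiam K ^ 2 := by
  have h0 := (elemDiam_pos K).le
  have h1 : closedTriangle K ⊆ Metric.closedBall (K.points 0) (elemDiam K) := fun x hx => by
    rw [Metric.mem_closedBall, dist_eq_norm]
    exact norm_sub_le_elemDiam K hx (points_mem_closedTriangle K 0)
  have h2 : volume.real (closedTriangle K) ≤
      volume.real (Metric.closedBall (K.points 0) (elemDiam K)) :=
    measureReal_mono h1 measure_closedBall_lt_top.ne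
  refine h2.trans ?_
  rw [measureReal_def, EuclideanSpace.volume_closedBall_fin_two]
  simp only [ENNReal.toReal_mul, ENNReal.toReal_pow, ENNReal.toReal_ofReal h0,
    ENNReal.toReal_ofReal Real.pi_pos.le]
  nlinarith [Real.pi_le_four, sq_nonneg (elemDiam K)]

theorem barycenter_mem_interior (K : Affine.Triangle ℝ Plane) :
    barycenter K ∈ interior (closedTriangle K) := by
  let β : AffineBasis (Fin 3) ℝ Plane := ⟨K.points, K.independent, by
    rw [K.independent.affineSpan_eq_top_iff_card_eq_finrank_add_one]; simp⟩
  have h := β.centroid_mem_interior_convexHull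
  have e : Finset.centroid ℝ Finset.univ β = barycenter K := by
    rw [Finset.centroid_def, Finset.affineCombination_eq_linear_combination]
    · simp [barycenter, Finset.smul_sum, Finset.centroidWeights]
      rfl
    · simp [Finset.centroidWeights]
  rw [e] at h
  exact h

theorem barycenter_mem (K : Affine.Triangle ℝ Plane) : barycenter K ∈ closedTriangle K :=
  interior_subset (barycenter_mem_interior K)

theorem lineMap_barycenter_mem_interior (K : Affine.Triangle ℝ Plane) {p : Plane}
    (hp : p ∈ closedTriangle K) {t : ℝ} (ht : t ∈ Ioc (0 : ℝ) 1) :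
    AffineMap.lineMap p (barycenter K) t ∈ interior (closedTriangle K) := by
  rw [AffineMap.lineMap_apply_module]
  exact (convex_closedTriangle K).combo_self_interior_mem_interior hp (barycenter_mem_interior K)
    (sub_nonneg.2 ht.2) ht.1 (by ring)

theorem edgeMidpoint_injective (K : Affine.Triangle ℝ Plane) :
    Function.Injective (edgeMidpoint K) := by
  -- Two sides share a vertex `q`, so equal midpoints would identify the other two vertices.
  have key : ∀ p q r : Plane, midpoint ℝ p q = midpoint ℝ q r → p = r := by
    intro p q r h
    rw [midpoint_comm, midpoint_eq_smul_add, midpoint_eq_smul_add] at h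
    simpa using h
  have hne := fun {i j : Fin 3} (h : i ≠ j) => K.independent.injective.ne h
  intro i j h
  unfold edgeMidpoint at h
  by_contra hij
  fin_cases i <;> fin_cases j <;>
    simp only [Fin.zero_eta, Fin.mk_one, Fin.reduceFinMk, zero_add, Fin.isValue, Fin.reduceAdd,
      not_true, Fin.reduceEq, not_false_iff] at h hij
  · exact hne (by decide) (key _ _ _ h)
  · exact hne (by decide) (key _ _ _ h.symm)
  · exact hne (by decide) (key _ _ _ h.symm)
  · exact hne (by decide) (key _ _ _ h)
  · exact hne (by decide) (key _ _ _ h)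
  · exact hne (by decide) (key _ _ _ h.symm)

/-- The part of the control volume of the `i`-th edge midpoint in the triangle `K`. -/
def subTriangle (K : Affine.Triangle ℝ Plane) (i : Fin 3) : Set Plane :=
  convexHull ℝ {K.points (i + 1), K.points (i + 2), barycenter K}

theorem subTriangle_subset (K : Affine.Triangle ℝ Plane) (i : Fin 3) :
    subTriangle K i ⊆ closedTriangle K := by
  refine convexHull_min ?_ (convex_closedTriangle K)
  simp [insert_subset_iff, points_mem_closedTriangle, barycenter_mem]

theorem isCompact_subTriangle (K : Affine.Triangle ℝ Plane) (i : Fin 3) :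
    IsCompact (subTriangle K i) :=
  (Set.toFinite _).isCompact_convexHull (𝕜 := ℝ)

variable {Ω : Set Plane}

/-! ### Restriction of the dual partition to one element -/

namespace Triangulation

theorem closedTriangle_subset (T : Triangulation Ω) {K : Affine.Triangle ℝ Plane}
    (hK : K ∈ T.elems) : closedTriangle K ⊆ closure Ω := by
  rw [← T.covers]
  exact subset_biUnion_of_mem (u := closedTriangle) hK

theorem edgeMidpoint_mem_midpoints (T : Triangulation Ω) {K : Affine.Triangle ℝ Plane}
    (hK : K ∈ T.elems) (i : Fin 3) : edgeMidpoint K i ∈ T.midpoints := by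
  classical
  simp only [midpoints, Finset.mem_biUnion, Finset.mem_image, Finset.mem_univ, true_and]
  exact ⟨K, hK, i, rfl⟩

/-- A common point is interior to at most one of the triangles, hence on the boundary of the other,
and the boundary of a convex set is null. -/
theorem volume_inter_eq_zero (T : Triangulation Ω) {K K' : Affine.Triangle ℝ Plane}
    (hK : K ∈ T.elems) (hK' : K' ∈ T.elems) (hne : K ≠ K') :
    volume (closedTriangle K ∩ closedTriangle K') = 0 := by
  have hsub : closedTriangle K ∩ closedTriangle K' ⊆
      frontier (closedTriangle K) ∪ frontier (closedTriangle K') := by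
    rintro x ⟨h1, h2⟩
    by_contra h
    simp only [mem_union, not_or, frontier, mem_sdiff, not_and, not_not] at h
    exact (T.disjoint_interior K hK K' hK' hne).le_bot
      ⟨h.1 (subset_closure h1), h.2 (subset_closure h2)⟩
  exact measure_mono_null hsub (measure_union_null
    ((convex_closedTriangle K).addHaar_frontier _) ((convex_closedTriangle K').addHaar_frontier _))

/-- The parts of the control volume coming from other elements meet `K` in a null set. -/
theorem controlVolume_inter_ae_eq (T : Triangulation Ω) {K : Affine.Triangle ℝ Plane}
    (hK : K ∈ T.elems) (M : Plane) :
    (T.controlVolume M ∩ closedTriangle K : Set Plane) =ᵐ[volume]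
      {x | ∃ i, edgeMidpoint K i = M ∧ x ∈ subTriangle K i} := by
  classical
  have hnull : volume (⋃ K' ∈ T.elems.erase K, closedTriangle K ∩ closedTriangle K') = 0 := by
    refine (measure_biUnion_null_iff (Finset.countable_toSet _)).2 fun K' hK' => ?_
    obtain ⟨h1, h2⟩ := Finset.mem_erase.1 hK'
    exact T.volume_inter_eq_zero hK h2 (Ne.symm h1)
  refine Filter.EventuallyLE.antisymm ?_ (LE.le.eventuallyLE ?_)
  · refine ae_le_set.2 (measure_mono_null ?_ hnull)
    rintro x ⟨⟨⟨K', hK', i, hi, hx⟩, hxK⟩, hn⟩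
    have hne : K' ≠ K := by
      rintro rfl
      exact hn ⟨i, hi, hx⟩
    simp only [mem_iUnion]
    exact ⟨K', Finset.mem_erase.2 ⟨hne, hK'⟩, hxK, subTriangle_subset K' i hx⟩
  · rintro x ⟨i, hi, hx⟩
    exact ⟨⟨K, hK, i, hi, hx⟩, subTriangle_subset K i hx⟩

/-- The integrals over `K*_M ∩ K` reduce to the three parts of `K`. -/
theorem sum_setIntegral_controlVolume (T : Triangulation Ω) {K : Affine.Triangle ℝ Plane}
    (hK : K ∈ T.elems) (f : Plane → Plane → ℝ) :
    ∑ M : T.midpoints, ∫ x in T.controlVolume M ∩ closedTriangle K, f M x =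
      ∑ i, ∫ x in subTriangle K i, f (edgeMidpoint K i) x := by
  classical
  have h1 : ∀ i, ∫ x in subTriangle K i, f (edgeMidpoint K i) x =
      ∫ x in T.controlVolume (edgeMidpoint K i) ∩ closedTriangle K, f (edgeMidpoint K i) x := by
    intro i
    rw [setIntegral_congr_set (T.controlVolume_inter_ae_eq hK _)]
    congr 2
    ext x
    simp only [(edgeMidpoint_injective K).eq_iff, mem_ofPred_eq, exists_eq_left]
  simp only [h1]
  rw [← Finset.sum_image (s := Finset.univ) (g := edgeMidpoint K)
    (f := fun M => ∫ x in T.controlVolume M ∩ closedTriangle K, f M x)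
    (fun i _ j _ h => edgeMidpoint_injective K h),
    Finset.sum_coe_sort T.midpoints
      (fun M => ∫ x in T.controlVolume M ∩ closedTriangle K, f M x)]
  symm
  refine Finset.sum_subset (fun M hM => ?_) fun M _ hM => ?_
  · obtain ⟨i, -, rfl⟩ := Finset.mem_image.1 hM
    exact T.edgeMidpoint_mem_midpoints hK i
  · rw [setIntegral_congr_set (T.controlVolume_inter_ae_eq hK _)]
    have : {x | ∃ i, edgeMidpoint K i = M ∧ x ∈ subTriangle K i} = ∅ := by
      ext x
      simp only [mem_ofPred_eq, mem_empty_iff_false, iff_false]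
      rintro ⟨i, hi, -⟩
      exact hM (Finset.mem_image.2 ⟨i, Finset.mem_univ _, hi⟩)
    rw [this, setIntegral_empty]

/-- Only the midpoints of the sides of `K` contribute to the integrals over the boundaries of the
control volumes in `K`. -/
theorem sum_innerBoundaryIntegral (T : Triangulation Ω) {K : Affine.Triangle ℝ Plane}
    (hK : K ∈ T.elems) (F : Plane → Plane → Plane → ℝ) :
    ∑ M : T.midpoints, innerBoundaryIntegral K M (F M) =
      ∑ i : Fin 3, (segmentIntegral (K.points (i + 1)) (barycenter K) (fun x => F (edgeMidpoint K i) x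
        (outwardNormal (K.points (i + 1)) (barycenter K) (K.points (i + 2)))) +
      segmentIntegral (K.points (i + 2)) (barycenter K) (fun x => F (edgeMidpoint K i) x
        (outwardNormal (K.points (i + 2)) (barycenter K) (K.points (i + 1))))) := by
  classical
  simp only [innerBoundaryIntegral]
  rw [Finset.sum_comm]
  refine Finset.sum_congr rfl fun i _ => ?_
  rw [Finset.sum_eq_single (⟨edgeMidpoint K i, T.edgeMidpoint_mem_midpoints hK i⟩ : T.midpoints)]
  · simp
  · intro M _ hM
    rw [if_neg fun h => hM (Subtype.ext h.symm)]
  · simp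

end Triangulation

/-! ### Affine functions -/

theorem exists_gradient_affine (f : Plane →ᵃ[ℝ] ℝ) :
    ∃ g : Plane, (∀ x, gradient f x = g) ∧ ∀ x y, f y - f x = inner ℝ g (y - x) := by
  set ℓ : Plane →L[ℝ] ℝ := LinearMap.toContinuousLinearMap f.linear with hℓ
  refine ⟨(InnerProductSpace.toDual ℝ Plane).symm ℓ, fun x => ?_, fun x y => ?_⟩
  · refine HasGradientAt.gradient ?_
    rw [hasGradientAt_iff_hasFDerivAt, LinearIsometryEquiv.apply_symm_apply, f.decomp]
    exact ℓ.hasFDerivAt.add_const (f 0)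
  · rw [InnerProductSpace.toDual_symm_apply, hℓ, LinearMap.coe_toContinuousLinearMap',
      ← vsub_eq_sub, ← vsub_eq_sub, AffineMap.linearMap_vsub]

/-! ### The reaction term -/

theorem neg_le_setIntegral_reaction {S K : Set Plane} (hS : IsCompact S) (hSK : S ⊆ K)
    (hK : volume K ≠ ⊤) {b w : Plane → ℝ} (hb : ContinuousOn b S) (hw : Continuous w) {B m δ : ℝ}
    (hb0 : ∀ x ∈ S, 0 ≤ b x) (hbB : ∀ x ∈ S, b x ≤ B) (hB : 0 ≤ B)
    (hwm : ∀ x ∈ S, |w x - m| ≤ δ) :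
    -(B * δ ^ 2 / 4 * volume.real K) ≤ ∫ x in S, b x * w x * m := by
  have hint : IntegrableOn (fun x => b x * w x * m) S :=
    ((hb.mul hw.continuousOn).mul continuousOn_const).integrableOn_compact hS
  have h1 : ∫ _ in S, -(B * δ ^ 2 / 4) ≤ ∫ x in S, b x * w x * m := by
    refine setIntegral_mono_on (integrableOn_const hS.measure_lt_top.ne) hint hS.measurableSet
      fun x hx => ?_
    have h2 : (w x - m) ^ 2 ≤ δ ^ 2 := sq_le_sq' (abs_le.1 (hwm x hx)).1 (abs_le.1 (hwm x hx)).2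
    have h3 : b x * (w x - m) ^ 2 ≤ B * δ ^ 2 :=
      mul_le_mul (hbB x hx) h2 (sq_nonneg _) hB
    nlinarith [mul_nonneg (hb0 x hx) (sq_nonneg (m + (w x - m) / 2))]
  have h4 : volume.real S ≤ volume.real K := measureReal_mono hSK hK
  rw [setIntegral_const, smul_eq_mul] at h1
  have h5 : 0 ≤ B * δ ^ 2 / 4 := by positivity
  nlinarith [mul_le_mul_of_nonneg_left h4 h5]

/-! ### The diffusion term -/

/-- The arc length factor cancels the normalization of the normal, leaving a sign and the
unnormalized vector `rot (q - p)`, so that later identities are polynomial. -/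
theorem segmentIntegral_flux (a : Plane → Matrix (Fin 2) (Fin 2) ℝ) (m : ℝ) (g p q c : Plane) :
    segmentIntegral p q (fun x => m * ((a x *ᵥ g.ofLp) ⬝ᵥ (outwardNormal p q c).ofLp)) =
      m * (if 0 < cross (q - p) (c - p) then -1 else 1) *
        ∫ t in (0 : ℝ)..1, (a (AffineMap.lineMap p q t) *ᵥ g.ofLp) ⬝ᵥ (rot (q - p)).ofLp := by
  have h : outwardNormal p q c = (if 0 < cross (q - p) (c - p) then (-1 : ℝ) else 1) •
      ‖q - p‖⁻¹ • rot (q - p) := by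
    unfold outwardNormal
    rw [inner_rot]
    split_ifs <;> simp
  rw [segmentIntegral, h]
  generalize (if 0 < cross (q - p) (c - p) then (-1 : ℝ) else 1) = s
  rcases eq_or_ne ‖q - p‖ 0 with h0 | h0
  · have h1 : q - p = 0 := norm_eq_zero.1 h0
    have h2 : (rot 0).ofLp = 0 := by ext i; fin_cases i <;> simp [rot]
    rw [h0, h1, h2]
    simp
  · rw [← intervalIntegral.integral_const_mul, ← intervalIntegral.integral_const_mul]
    congr 1
    ext t
    simp only [WithLp.ofLp_smul, dotProduct_smul, smul_eq_mul]
    field_simp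

theorem abs_mulVec_dotProduct_sub_le {A A' : Matrix (Fin 2) (Fin 2) ℝ} {ε : ℝ}
    (h : ∀ i j, |A i j - A' i j| ≤ ε) (g n : Plane) :
    |(A *ᵥ g.ofLp) ⬝ᵥ n.ofLp - (A' *ᵥ g.ofLp) ⬝ᵥ n.ofLp| ≤ 4 * ε * ‖g‖ * ‖n‖ := by
  have hε : 0 ≤ ε := (abs_nonneg _).trans (h 0 0)
  have key : ∀ i j, |(A i j - A' i j) * g j * n i| ≤ ε * ‖g‖ * ‖n‖ := by
    intro i j
    rw [abs_mul, abs_mul]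
    have h1 : |g j| ≤ ‖g‖ := PiLp.norm_apply_le g j
    have h2 : |n i| ≤ ‖n‖ := PiLp.norm_apply_le n i
    have h3 := h i j
    gcongr
  have e : (A *ᵥ g.ofLp) ⬝ᵥ n.ofLp - (A' *ᵥ g.ofLp) ⬝ᵥ n.ofLp =
      (A 0 0 - A' 0 0) * g 0 * n 0 + (A 0 1 - A' 0 1) * g 1 * n 0 +
      ((A 1 0 - A' 1 0) * g 0 * n 1 + (A 1 1 - A' 1 1) * g 1 * n 1) := by
    simp [Matrix.mulVec, dotProduct, Fin.sum_univ_two]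
    ring
  rw [e]
  refine (abs_add_le _ _).trans ?_
  have := abs_add_le ((A 0 0 - A' 0 0) * g 0 * n 0) ((A 0 1 - A' 0 1) * g 1 * n 0)
  have := abs_add_le ((A 1 0 - A' 1 0) * g 0 * n 1) ((A 1 1 - A' 1 1) * g 1 * n 1)
  linarith [key 0 0, key 0 1, key 1 0, key 1 1]

/-- The parameter `t = 0` is left out because `p` will be a vertex of an element, possibly on `∂Ω`,
where the coefficients are not controlled. Integrability comes from boundedness on the half-open
interval. -/
theorem abs_integral_flux_sub_le {U : Set Plane} {a : Plane → Matrix (Fin 2) (Fin 2) ℝ}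
    {p q g n : Plane} {ε : ℝ} (hcont : ∀ i j, ContinuousOn (fun x => a x i j) U)
    (hU : ∀ t ∈ Ioc (0 : ℝ) 1, AffineMap.lineMap p q t ∈ U)
    (hε : ∀ x ∈ U, ∀ i j, |a x i j - a q i j| ≤ ε) :
    |(∫ t in (0 : ℝ)..1, (a (AffineMap.lineMap p q t) *ᵥ g.ofLp) ⬝ᵥ n.ofLp) -
      (a q *ᵥ g.ofLp) ⬝ᵥ n.ofLp| ≤ 4 * ε * ‖g‖ * ‖n‖ := by
  set F : ℝ → ℝ := fun t => (a (AffineMap.lineMap p q t) *ᵥ g.ofLp) ⬝ᵥ n.ofLp -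
    (a q *ᵥ g.ofLp) ⬝ᵥ n.ofLp with hF
  have hbound : ∀ t ∈ Ioc (0 : ℝ) 1, ‖F t‖ ≤ 4 * ε * ‖g‖ * ‖n‖ := fun t ht =>
    abs_mulVec_dotProduct_sub_le (hε _ (hU t ht)) g n
  have hFc : ContinuousOn F (Ioc 0 1) := by
    have hc : ∀ i j, ContinuousOn (fun t : ℝ => a (AffineMap.lineMap p q t) i j) (Ioc 0 1) :=
      fun i j => (hcont i j).comp AffineMap.lineMap_continuous.continuousOn hU
    simp only [hF, Matrix.mulVec, dotProduct, Fin.sum_univ_two]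
    exact (((((hc 0 0).mul continuousOn_const).add ((hc 0 1).mul continuousOn_const)).mul
      continuousOn_const).add ((((hc 1 0).mul continuousOn_const).add
      ((hc 1 1).mul continuousOn_const)).mul continuousOn_const)).sub continuousOn_const
  have hFi : IntervalIntegrable F volume 0 1 := by
    rw [intervalIntegrable_iff_integrableOn_Ioc_of_le zero_le_one]
    exact IntegrableOn.of_bound (by simp) (hFc.aestronglyMeasurable measurableSet_Ioc) _
      ((ae_restrict_iff' measurableSet_Ioc).2 (.of_forall hbound))
  have e : ∫ t in (0 : ℝ)..1, (a (AffineMap.lineMap p q t) *ᵥ g.ofLp) ⬝ᵥ n.ofLp =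
      (∫ t in (0 : ℝ)..1, F t) + (a q *ᵥ g.ofLp) ⬝ᵥ n.ofLp := by
    have h1 : (fun t : ℝ => (a (AffineMap.lineMap p q t) *ᵥ g.ofLp) ⬝ᵥ n.ofLp) =
        fun t => F t + (a q *ᵥ g.ofLp) ⬝ᵥ n.ofLp := by ext t; simp [hF]
    rw [h1, intervalIntegral.integral_add hFi intervalIntegrable_const]
    simp
  rw [e, add_sub_cancel_right]
  have := intervalIntegral.norm_integral_le_of_norm_le_const (a := (0 : ℝ)) (b := 1) (f := F)
    (C := 4 * ε * ‖g‖ * ‖n‖) (by rwa [uIoc_of_le zero_le_one])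
  simpa using this

/-- The barycenter cuts `K` into three triangles of equal area with the orientation of `K`, so the
sign of the normal depends on that orientation alone and not on `i`. -/
theorem ite_cross_left {K : Affine.Triangle ℝ Plane} (h : signedArea K ≠ 0) (i : Fin 3) :
    (if 0 < cross (barycenter K - K.points (i + 1)) (K.points (i + 2) - K.points (i + 1)) then
      (-1 : ℝ) else 1) = if 0 < signedArea K then 1 else -1 := by
  have e : cross (barycenter K - K.points (i + 1)) (K.points (i + 2) - K.points (i + 1)) =
      -(signedArea K / 3) := by
    fin_cases i <;> simp [cross, signedArea, barycenter, Fin.sum_univ_three] <;> ring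
  rw [e]
  rcases lt_or_gt_of_ne h with h | h
  · rw [if_pos (by linarith), if_neg (by linarith)]
  · rw [if_neg (by linarith), if_pos h]

theorem ite_cross_right {K : Affine.Triangle ℝ Plane} (h : signedArea K ≠ 0) (i : Fin 3) :
    (if 0 < cross (barycenter K - K.points (i + 2)) (K.points (i + 1) - K.points (i + 2)) then
      (-1 : ℝ) else 1) = -if 0 < signedArea K then 1 else -1 := by
  have e : cross (barycenter K - K.points (i + 2)) (K.points (i + 1) - K.points (i + 2)) =
      signedArea K / 3 := by
    fin_cases i <;> simp [cross, signedArea, barycenter, Fin.sum_univ_three] <;> ring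
  rw [e]
  rcases lt_or_gt_of_ne h with h | h
  · rw [if_neg (by linarith), if_neg (by linarith), neg_neg]
  · rw [if_pos (by linarith), if_pos h]

/-- The discrete Gauss formula on a triangle for a constant coefficient matrix. -/
theorem sum_const_flux (K : Affine.Triangle ℝ Plane) (A : Matrix (Fin 2) (Fin 2) ℝ) (g : Plane) :
    ∑ k : Fin 3, (A *ᵥ g.ofLp) ⬝ᵥ (rot (barycenter K - K.points k)).ofLp *
      inner ℝ g (K.points (k + 2) - K.points (k + 1)) =
      signedArea K * ∑ i, ∑ j, A i j * g i * g j := by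
  have e : ∀ k, inner ℝ g (K.points (k + 2) - K.points (k + 1)) =
      g 0 * (K.points (k + 2) 0 - K.points (k + 1) 0) +
        g 1 * (K.points (k + 2) 1 - K.points (k + 1) 1) := fun k => by
    rw [inner_eq_coord]; simp
  simp only [e]
  simp [Fin.sum_univ_three, Fin.sum_univ_two, Matrix.mulVec, dotProduct, rot, signedArea, cross,
    barycenter]
  ring

theorem inner_edgeMidpoint_sub (K : Affine.Triangle ℝ Plane) (g : Plane) (k : Fin 3) :
    inner ℝ g (edgeMidpoint K (k + 2) - edgeMidpoint K (k + 1)) =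
      - (inner ℝ g (K.points (k + 2) - K.points (k + 1)) / 2) := by
  simp only [inner_eq_coord, edgeMidpoint, midpoint_eq_smul_add]
  fin_cases k <;> simp <;> ring

/-- Lower bound for the diffusion part of the local form, by comparison with the coefficients frozen
at the barycenter. -/
theorem le_diffusion {K : Affine.Triangle ℝ Plane} (hD : signedArea K ≠ 0)
    {a : Plane → Matrix (Fin 2) (Fin 2) ℝ} {f : Plane →ᵃ[ℝ] ℝ} {g : Plane}
    (hf : ∀ x y, f y - f x = inner ℝ g (y - x)) {ε r : ℝ}
    (hcont : ∀ i j, ContinuousOn (fun x => a x i j) (interior (closedTriangle K)))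
    (hε : ∀ x ∈ interior (closedTriangle K), ∀ i j, |a x i j - a (barycenter K) i j| ≤ ε)
    (hr : r * ∑ j, g j ^ 2 ≤ ∑ i, ∑ j, a (barycenter K) i j * g i * g j) :
    |signedArea K| / 2 * (r * ‖g‖ ^ 2) - 6 * ε * elemDiam K ^ 2 * ‖g‖ ^ 2 ≤
      -∑ i : Fin 3, (segmentIntegral (K.points (i + 1)) (barycenter K) (fun x =>
        f (edgeMidpoint K i) * ((a x *ᵥ g.ofLp) ⬝ᵥ
          (outwardNormal (K.points (i + 1)) (barycenter K) (K.points (i + 2))).ofLp)) +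
      segmentIntegral (K.points (i + 2)) (barycenter K) (fun x =>
        f (edgeMidpoint K i) * ((a x *ᵥ g.ofLp) ⬝ᵥ
          (outwardNormal (K.points (i + 2)) (barycenter K) (K.points (i + 1))).ofLp))) := by
  simp only [segmentIntegral_flux, ite_cross_left hD, ite_cross_right hD]
  set s : ℝ := if 0 < signedArea K then 1 else -1 with hs
  set J : Fin 3 → ℝ := fun k => ∫ t in (0 : ℝ)..1,
    (a (AffineMap.lineMap (K.points k) (barycenter K) t) *ᵥ g.ofLp) ⬝ᵥ
      (rot (barycenter K - K.points k)).ofLp with hJ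
  set J₀ : Fin 3 → ℝ := fun k => (a (barycenter K) *ᵥ g.ofLp) ⬝ᵥ
    (rot (barycenter K - K.points k)).ofLp with hJ₀
  set y : Fin 3 → ℝ := fun k => inner ℝ g (K.points (k + 2) - K.points (k + 1)) with hy
  have hsD : s * signedArea K = |signedArea K| := by
    rw [hs]
    split_ifs with h
    · rw [one_mul, abs_of_pos h]
    · rw [neg_one_mul, abs_of_nonpos (not_lt.1 h)]
  have hs1 : |s| = 1 := by rw [hs]; split_ifs <;> simp
  have hε0 : 0 ≤ ε := (abs_nonneg _).trans (hε _ (barycenter_mem_interior K) 0 0)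
  have hh := (elemDiam_pos K).le
  have hJJ : ∀ k, |J k - J₀ k| ≤ 4 * ε * ‖g‖ * elemDiam K := by
    intro k
    refine (abs_integral_flux_sub_le hcont (fun t ht =>
      lineMap_barycenter_mem_interior K (points_mem_closedTriangle K k) ht) hε).trans ?_
    rw [norm_rot]
    exact mul_le_mul_of_nonneg_left
      (norm_sub_le_elemDiam K (barycenter_mem K) (points_mem_closedTriangle K k)) (by positivity)
  have hyb : ∀ k, |y k| ≤ ‖g‖ * elemDiam K := fun k =>
    (abs_real_inner_le_norm _ _).trans (mul_le_mul_of_nonneg_left (norm_sub_le_elemDiam K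
      (points_mem_closedTriangle K _) (points_mem_closedTriangle K _)) (norm_nonneg _))
  have hm : ∀ k, f (edgeMidpoint K (k + 2)) - f (edgeMidpoint K (k + 1)) = -(y k / 2) := fun k => by
    rw [hf, inner_edgeMidpoint_sub]
  -- Summation by parts: modulo 3, the segment from vertex `k` occurs for `i = k + 2` with sign `s`
  -- and for `i = k + 1` with sign `-s`.
  have hsum : -∑ i : Fin 3, (f (edgeMidpoint K i) * s * J (i + 1) +
      f (edgeMidpoint K i) * -s * J (i + 2)) = s / 2 * ∑ k, J k * y k := by
    have h0 := hm 0
    have h1 := hm 1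
    have h2 := hm 2
    simp only [Fin.sum_univ_three, Fin.isValue, zero_add, Fin.reduceAdd] at *
    linear_combination (-s * J 0) * h0 + (-s * J 1) * h1 + (-s * J 2) * h2
  rw [hsum]
  have hsplit : s / 2 * ∑ k, J k * y k =
      |signedArea K| / 2 * (∑ i, ∑ j, a (barycenter K) i j * g i * g j) +
        s / 2 * ∑ k, (J k - J₀ k) * y k := by
    have h := sum_const_flux K (a (barycenter K)) g
    rw [← hsD]
    simp only [sub_mul, Finset.sum_sub_distrib]
    linear_combination (s / 2) * h
  -- The constant 6 is one half times three segments times the 4 matrix entries.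
  have herr : |s / 2 * ∑ k, (J k - J₀ k) * y k| ≤ 6 * ε * elemDiam K ^ 2 * ‖g‖ ^ 2 := by
    have h1 : |∑ k, (J k - J₀ k) * y k| ≤
        ∑ _k : Fin 3, 4 * ε * ‖g‖ * elemDiam K * (‖g‖ * elemDiam K) :=
      (Finset.abs_sum_le_sum_abs _ _).trans (Finset.sum_le_sum fun k _ => by
        rw [abs_mul]
        exact mul_le_mul (hJJ k) (hyb k) (abs_nonneg _) (by positivity))
    rw [abs_mul, abs_div, hs1]
    simp only [Finset.sum_const, Finset.card_univ, Fintype.card_fin, nsmul_eq_mul,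
      Nat.cast_ofNat] at h1
    rw [abs_of_pos (by norm_num : (0 : ℝ) < 2)]
    linarith
  have hell : r * ‖g‖ ^ 2 ≤ ∑ i, ∑ j, a (barycenter K) i j * g i * g j := by
    rw [norm_sq_eq_coord, ← Fin.sum_univ_two (fun j => g j ^ 2)]
    exact hr
  rw [hsplit]
  have := mul_le_mul_of_nonneg_left hell (by positivity : 0 ≤ |signedArea K| / 2)
  linarith [(abs_le.1 herr).1]

/-! ### Ellipticity -/

/-- Lower bound for the contribution of a single element. -/
theorem Triangulation.le_localForm (T : Triangulation Ω) {K : T.elems} (w : T.trialSpace)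
    {a : Plane → Matrix (Fin 2) (Fin 2) ℝ} {b : Plane → ℝ} {g : Plane} {r L B : ℝ}
    (hD : signedArea K.1 ≠ 0) (hg : ∀ x, gradient (w.1 K) x = g)
    (hf : ∀ x y, w.1 K y - w.1 K x = inner ℝ g (y - x))
    (ha_cont : ∀ i j, ContinuousOn (fun x => a x i j) Ω) (hL : 0 ≤ L)
    (ha_lip : ∀ i j x y, segment ℝ x y ⊆ Ω → |a y i j - a x i j| ≤ L * ‖y - x‖)
    (ha_ell : ∀ x ∈ Ω, ∀ ξ : Fin 2 → ℝ, r * ∑ j, ξ j ^ 2 ≤ ∑ i, ∑ j, a x i j * ξ i * ξ j)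
    (hb : ContinuousOn b (closure Ω)) (hb0 : ∀ x ∈ closure Ω, 0 ≤ b x)
    (hbB : ∀ x ∈ closure Ω, b x ≤ B) (hB : 0 ≤ B) :
    |signedArea K.1| / 2 * (r * ‖g‖ ^ 2) - 6 * (L * elemDiam K.1) * elemDiam K.1 ^ 2 * ‖g‖ ^ 2 -
        3 * (B * (‖g‖ * elemDiam K.1) ^ 2 / 4 * volume.real (closedTriangle K.1)) ≤
      T.localForm a b K (w.1 K) (T.proj w).1 := by
  have hint := T.interior_subset K.1 K.2
  have hclos := T.closedTriangle_subset K.2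
  have hval : ∀ i, ∀ M : T.midpoints, edgeMidpoint K.1 i = M →
      (T.proj w).1 M = w.1 K (edgeMidpoint K.1 i) := fun i M hM => by
    rw [T.proj_apply w M K (hM ▸ edgeMidpoint_mem_closedTriangle K.1 i), hM]
  classical
  -- Extension by zero to all points, as the summation lemmas take integrands indexed by the plane.
  set m : Plane → ℝ := fun M => if h : M ∈ T.midpoints then (T.proj w).1 ⟨M, h⟩ else 0 with hm
  have hmM : ∀ M : T.midpoints, (T.proj w).1 M = m M := fun M => by simp [hm, M.2]
  have hmi : ∀ i, m (edgeMidpoint K.1 i) = w.1 K (edgeMidpoint K.1 i) := fun i => by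
    rw [← hval i ⟨_, T.edgeMidpoint_mem_midpoints K.2 i⟩ rfl, hmM]
  have hdif := le_diffusion hD hf (ε := L * elemDiam K.1) (r := r)
    (fun i j => (ha_cont i j).mono hint)
    -- The segment from the barycenter to `x` stays in the interior of `K`, hence in `Ω`, where the
    -- Lipschitz bound along segments applies.
    (fun x hx i j => by
      refine (ha_lip i j _ x (((convex_closedTriangle K.1).interior.segment_subset
        (barycenter_mem_interior K.1) hx).trans hint)).trans ?_
      exact mul_le_mul_of_nonneg_left
        (norm_sub_le_elemDiam K.1 (_root_.interior_subset hx) (barycenter_mem K.1)) hL)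
    (ha_ell _ (hint (barycenter_mem_interior K.1)) g)
  have hrea : ∑ _i : Fin 3, -(B * (‖g‖ * elemDiam K.1) ^ 2 / 4 * volume.real (closedTriangle K.1)) ≤
      ∑ i : Fin 3, ∫ x in subTriangle K.1 i, b x * w.1 K x * w.1 K (edgeMidpoint K.1 i) := by
    refine Finset.sum_le_sum fun i _ => ?_
    have hsub := subTriangle_subset K.1 i
    refine neg_le_setIntegral_reaction (isCompact_subTriangle K.1 i) hsub
      (isCompact_closedTriangle K.1).measure_lt_top.ne (hb.mono (hsub.trans hclos))
      (w.1 K).continuous_of_finiteDimensional (fun x hx => hb0 x (hclos (hsub hx)))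
      (fun x hx => hbB x (hclos (hsub hx))) hB fun x hx => ?_
    rw [hf]
    exact (abs_real_inner_le_norm _ _).trans (mul_le_mul_of_nonneg_left
      (norm_sub_le_elemDiam K.1 (hsub hx) (edgeMidpoint_mem_closedTriangle K.1 i)) (norm_nonneg _))
  simp only [Finset.sum_const, Finset.card_univ, Fintype.card_fin, nsmul_eq_mul,
    Nat.cast_ofNat] at hrea
  have hform : T.localForm a b K (w.1 K) (T.proj w).1 =
      (∑ M : T.midpoints, ∫ x in T.controlVolume M ∩ closedTriangle K.1, b x * w.1 K x * m M) -
      ∑ M : T.midpoints, innerBoundaryIntegral K.1 M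
        (fun x n => m M * ((a x *ᵥ g.ofLp) ⬝ᵥ n.ofLp)) := by
    simp only [Triangulation.localForm, Finset.sum_sub_distrib, hmM, hg]
  rw [hform, T.sum_setIntegral_controlVolume K.2 (fun M x => b x * w.1 K x * m M),
    T.sum_innerBoundaryIntegral K.2 (fun M x n => m M * ((a x *ᵥ g.ofLp) ⬝ᵥ n.ofLp))]
  simp only [hmi]
  linarith

/-- Boundedness of `Ω` is essential here: the real `sSup` of an unbounded set is the default value
0. -/
theorem elemDiam_le_meshSize (hΩ : Bornology.IsBounded Ω) {𝒯 : Set (Triangulation Ω)}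
    {T : Triangulation Ω} (hT : T ∈ 𝒯) {K : Affine.Triangle ℝ Plane} (hK : K ∈ T.elems) :
    elemDiam K ≤ meshSize 𝒯 := by
  refine le_csSup ⟨Metric.diam (closure Ω), ?_⟩ ⟨T, hT, K, hK, rfl⟩
  rintro _ ⟨T', -, K', hK', rfl⟩
  exact Metric.diam_mono (T'.closedTriangle_subset hK') hΩ.closure

end CRFVM

open CRFVM in
theorem proposition3p2 (Ω : Set CRFVM.Plane) (hΩ : CRFVM.IsPolygonalDomain Ω)
    (a : CRFVM.Plane → Matrix (Fin 2) (Fin 2) ℝ)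
    (ha_symm : ∀ x ∈ Ω, (a x).IsSymm)
    (ha_W1 : ∀ i j, CRFVM.MemW1Infty Ω (fun x => a x i j))
    (ha_cont : ∀ i j, ContinuousOn (fun x => a x i j) Ω)
    (r : ℝ) (hr : 0 < r)
    (ha_ell : ∀ x ∈ Ω, ∀ ξ : Fin 2 → ℝ, r * ∑ j, ξ j ^ 2 ≤ ∑ i, ∑ j, a x i j * ξ i * ξ j)
    (b : CRFVM.Plane → ℝ) (hb_smooth : ContDiffOn ℝ ∞ b (closure Ω))
    (hb_nonneg : ∀ x ∈ Ω, 0 ≤ b x)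
    (ϱ : ℝ) (hϱ : 0 < ϱ) :
    ∃ h₀ : ℝ, 0 < h₀ ∧ ∀ 𝒯 : Set (CRFVM.Triangulation Ω),
      CRFVM.IsRegularWith ϱ 𝒯 → CRFVM.meshSize 𝒯 < h₀ → CRFVM.UniformlyElliptic a b 𝒯 := by
  choose L' hL' hlip using fun i j => (ha_W1 i j).exists_lipschitz hΩ.isOpen (ha_cont i j)
  set L : ℝ := ∑ i, ∑ j, L' i j with hLdef
  have hL : 0 ≤ L := Finset.sum_nonneg fun i _ => Finset.sum_nonneg fun j _ => hL' i j
  have ha_lip : ∀ i j x y, segment ℝ x y ⊆ Ω → |a y i j - a x i j| ≤ L * ‖y - x‖ := by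
    intro i j x y hxy
    refine (hlip i j x y hxy).trans (mul_le_mul_of_nonneg_right ?_ (norm_nonneg _))
    exact (Finset.single_le_sum (f := fun j => L' i j) (fun j _ => hL' i j)
      (Finset.mem_univ j)).trans (Finset.single_le_sum (f := fun i => ∑ j, L' i j)
      (fun i _ => Finset.sum_nonneg fun j _ => hL' i j) (Finset.mem_univ i))
  have hb := hb_smooth.continuousOn
  have hb0 : ∀ x ∈ closure Ω, 0 ≤ b x := fun x hx =>
    closure_minimal (image_subset_iff.2 hb_nonneg) isClosed_Ici (hb.image_closure ⟨x, hx, rfl⟩)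
  obtain ⟨B, hbB⟩ := (hΩ.isBounded.isCompact_closure.bddAbove_image hb)
  have hbB : ∀ x ∈ closure Ω, b x ≤ B := fun x hx => hbB ⟨x, hx, rfl⟩
  have hB : 0 ≤ B := by
    obtain ⟨x, hx⟩ := hΩ.isConnected.nonempty
    exact (hb0 x (subset_closure hx)).trans (hbB x (subset_closure hx))
  -- `6 * L` collects the coefficient freezing error, and `3 * B` the three reaction losses after `V
  -- ≤ 4 * h ^ 2` and `h ≤ 1`.
  set C : ℝ := 6 * L + 3 * B with hC
  have hC0 : 0 ≤ C := by positivity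
  -- `C + 1` keeps the denominator positive when `C = 0`; the bound makes the total loss at most `r
  -- / 4 * D`, half of the main term `r / 2 * D`.
  refine ⟨min 1 (r * ϱ / (4 * (C + 1))), by positivity, fun 𝒯 hreg hmesh => ?_⟩
  -- The remaining `r / 4 * D` dominates `r * ϱ / 4 * h ^ 2`, and the crude bound `V ≤ 4 * h ^ 2`
  -- turns this into the factor 1/16.
  refine ⟨r * ϱ / 16, by positivity, fun T hT w => ?_⟩
  rw [Triangulation.brokenNorm, Real.sq_sqrt (Finset.sum_nonneg fun K _ =>
    integral_nonneg fun x => sq_nonneg _), Finset.mul_sum]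
  refine Finset.sum_le_sum fun K _ => ?_
  obtain ⟨g, hg, hf⟩ := exists_gradient_affine (w.1 K)
  set h := elemDiam K.1 with hh
  set D := |signedArea K.1| with hDdef
  set V := volume.real (closedTriangle K.1) with hV
  have hpos : 0 < h := elemDiam_pos K.1
  have hlt : h < min 1 (r * ϱ / (4 * (C + 1))) :=
    (elemDiam_le_meshSize hΩ.isBounded hT K.2).trans_lt hmesh
  have hh1 : h ≤ 1 := (hlt.trans_le (min_le_left _ _)).le
  have hh2 : C * h ≤ r * ϱ / 4 := by
    have := (hlt.trans_le (min_le_right _ _)).le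
    rw [le_div_iff₀ (by positivity)] at this
    linarith
  have hDh : ϱ * h ^ 2 ≤ D := mul_elemDiam_sq_le (hreg T hT K.1 K.2)
  have hD0 : 0 < D := lt_of_lt_of_le (by positivity) hDh
  have hVh : V ≤ 4 * h ^ 2 := volume_closedTriangle_le K.1
  refine le_trans ?_ (T.le_localForm w (abs_pos.1 hD0) hg hf ha_cont hL ha_lip ha_ell hb hb0 hbB hB)
  simp only [hg, setIntegral_const, smul_eq_mul]
  change r * ϱ / 16 * (V * ‖g‖ ^ 2) ≤ D / 2 * (r * ‖g‖ ^ 2) - 6 * (L * h) * h ^ 2 * ‖g‖ ^ 2 -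
    3 * (B * (‖g‖ * h) ^ 2 / 4 * V)
  have hBV : B * h ^ 2 * V ≤ 4 * B * h * h ^ 2 := by
    have h1 : B * h ^ 2 * V ≤ B * h ^ 2 * (4 * h ^ 2) := mul_le_mul_of_nonneg_left hVh (by positivity)
    have h2 : B * h ^ 2 * (4 * h ^ 2) = 4 * B * h * h ^ 2 * h := by ring
    have h3 : 4 * B * h * h ^ 2 * h ≤ 4 * B * h * h ^ 2 * 1 :=
      mul_le_mul_of_nonneg_left hh1 (by positivity)
    linarith
  have hCh : C * h * h ^ 2 ≤ r / 4 * D := by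
    have h1 := mul_le_mul_of_nonneg_right hh2 (sq_nonneg h)
    have h2 := mul_le_mul_of_nonneg_left hDh (by positivity : 0 ≤ r / 4)
    linarith
  have hσ : r * ϱ / 16 * V ≤ r / 4 * D := by
    have h1 := mul_le_mul_of_nonneg_left hVh (by positivity : 0 ≤ r * ϱ / 16)
    have h2 := mul_le_mul_of_nonneg_left hDh (by positivity : 0 ≤ r / 4)
    linarith
  have key : r * ϱ / 16 * V ≤ D / 2 * r - 6 * (L * h) * h ^ 2 - 3 * (B * h ^ 2 / 4 * V) := by
    have e : C * h * h ^ 2 = 6 * (L * h) * h ^ 2 + 3 * (B * h * h ^ 2) := by rw [hC]; ring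
    linarith
  have := mul_le_mul_of_nonneg_right key (sq_nonneg ‖g‖)
  linarith
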